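/- Let $F$ be a field of characteristic different from two, let $n\ge 0$, let $K=F(\!(x_1)\!)\cdots(\!(x_n)\!)$ be the iterated Laurent series field in $n$ variables over $F$, and let $\pi=\langle 1,x_1\rangle\otimes\cdots\otimes\langle 1,x_n\rangle$ over $K$ (with $\pi=\langle 1\rangle$ if $n=0$). "Form" means regular (finite-dimensional) quadratic form. For a form $\varphi$ over $F$, the product $\varphi\otimes\pi$ means $\varphi_K\otimes\pi$, where $\varphi_K$ is $\varphi$ viewed as a form over $K$. A Pfister form over a field $E$ is a form isometric to $\langle 1,a_1\rangle\otimes\cdots\otimes\langle 1,a_m\rangle$ for some $m\ge 0$ and $a_1,\dots,a_m\in E^\times$ (to $\langle 1\rangle$ if $m=0$). A form $\tau$ over $E$ is a neighbour of a Pfister form $\gamma$ over $E$ if $\dim\tau>\frac12\dim\gamma$ and there are $a\in E^\times$ and a form $\delta$ over $E$ with $\tau\perp\delta\simeq a\gamma$. Let $q$ be an anisotropic form over $F$, and let $\rho$ be an anisotropic Pfister form over $F$. Then: (i) $q\otimes\pi$ is a neighbour of some Pfister form over $K$ if and only if there is a Pfister form $\sigma$ over $F$ such that $q\otimes\pi$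 is a neighbour of the Pfister form $\sigma\otimes\pi$ over $K$. (ii) $q\otimes\pi$ is a neighbour of the Pfister form $\rho\otimes\pi$ over $K$ if and only if $q$ is a neighbour of $\rho$ over $F$. -/

import Mathlib

open scoped TensorProduct

universe u v w

noncomputable section

/-- The binary quadratic form `⟨1, a⟩`, that is `X₁² + a X₂²`. -/
def oneForm {F : Type u} [Field F] (a : F) : QuadraticForm F (Fin 2 → F) :=
  QuadraticMap.weightedSumSquares F ![1, a]

/-- The quadratic space `⟨1, a₁⟩ ⊗ ⋯ ⊗ ⟨1, aₙ⟩` attached to the list `[a₁, …, aₙ]`;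
for the empty list this is `⟨1⟩`. -/
def pfisterSpace {F : Type u} [Field F] [Invertible (2 : F)] :
    List F → QuadraticModuleCat.{u} F
  | [] => QuadraticModuleCat.of (QuadraticMap.sq (R := F))
  | a :: l => QuadraticModuleCat.of ((oneForm a).tmul (pfisterSpace l).form)

/-- The quadratic form `⟨1, a₁⟩ ⊗ ⋯ ⊗ ⟨1, aₙ⟩`. -/
def pfisterForm {F : Type u} [Field F] [Invertible (2 : F)] (l : List F) :
    QuadraticForm F (pfisterSpace l) :=
  (pfisterSpace l).form

/-- `Q` is an `n`-fold Pfister form for some `n ≥ 0`: it is isometric to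
`⟨1, a₁⟩ ⊗ ⋯ ⊗ ⟨1, aₙ⟩` with all `aᵢ` nonzero. -/
def IsPfister {F : Type u} [Field F] [Invertible (2 : F)]
    {V : Type v} [AddCommMonoid V] [Module F V] (Q : QuadraticForm F V) : Prop :=
  ∃ l : List F, (∀ a ∈ l, a ≠ 0) ∧ Q.Equivalent (pfisterForm l)

/-- `p` is a subform of `q`: `q ≃ p ⊥ r` for some regular form `r`. Up to isometry `r` may be
taken on a coordinate space. -/
def IsSubform {F : Type u} [Field F]
    {V : Type v} [AddCommMonoid V] [Module F V] {W : Type w} [AddCommMonoid W] [Module F W]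
    (p : QuadraticForm F V) (q : QuadraticForm F W) : Prop :=
  ∃ (k : ℕ) (r : QuadraticForm F (Fin k → F)), r.Nondegenerate ∧ q.Equivalent (p.prod r)

/-- `τ` is a neighbour of the Pfister form `P`: `P` is a Pfister form, `τ` is a subform of `a P`
for some nonzero scalar `a`, and `dim τ > (dim P) / 2`. -/
def IsNeighbour {F : Type u} [Field F] [Invertible (2 : F)]
    {V : Type v} [AddCommMonoid V] [Module F V] {W : Type w} [AddCommMonoid W] [Module F W]
    (τ : QuadraticForm F V) (P : QuadraticForm F W) : Prop :=
  IsPfister P ∧ (∃ a : F, a ≠ 0 ∧ IsSubform τ (a • P)) ∧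
    Module.finrank F W < 2 * Module.finrank F V

/-- The iterated Laurent series field `F((x₁))((x₂))⋯((xₙ))`. -/
def IterLaurent : (n : ℕ) → (F : Type u) → [Field F] → Type u
  | 0, F, _ => F
  | n + 1, F, _ => IterLaurent n (LaurentSeries F)

namespace IterLaurent

/-- The field structure on `F((x₁))⋯((xₙ))`. -/
instance instField : (n : ℕ) → (F : Type u) → [_inst : Field F] → Field (IterLaurent n F)
  | 0, _, inst => inst
  | n + 1, F, _ => instField n (LaurentSeries F)

/-- The embedding of `F` into `F((x₁))⋯((xₙ))` as constants. -/
def const : (n : ℕ) → (F : Type u) → [Field F] → F →+* IterLaurent n F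
  | 0, F, _ => RingHom.id F
  | n + 1, F, _ =>
    (const n (LaurentSeries F)).comp (HahnSeries.C : F →+* LaurentSeries F)

instance (n : ℕ) (F : Type u) [Field F] : Algebra F (IterLaurent n F) := (const n F).toAlgebra

instance (n : ℕ) (F : Type u) [Field F] [Invertible (2 : F)] :
    Invertible (2 : IterLaurent n F) :=
  (Invertible.map (const n F) 2).copy 2 (map_ofNat _ _).symm

/-- The list `[x₁, …, xₙ]` of the variables of `F((x₁))⋯((xₙ))`. -/
def vars : (n : ℕ) → (F : Type u) → [Field F] → List (IterLaurent n F)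
  | 0, _, _ => []
  | n + 1, F, _ =>
    const n (LaurentSeries F) (HahnSeries.single (1 : ℤ) (1 : F)) :: vars n (LaurentSeries F)

end IterLaurent

/-- The generic `n`-fold Pfister form `⟨1, x₁⟩ ⊗ ⋯ ⊗ ⟨1, xₙ⟩` over `F((x₁))⋯((xₙ))`. -/
def genericPfister (n : ℕ) (F : Type u) [Field F] [Invertible (2 : F)] :
    QuadraticForm (IterLaurent n F) (pfisterSpace (IterLaurent.vars n F)) :=
  pfisterForm (IterLaurent.vars n F)

/-- The product `q ⊗ π` over `K = F((x₁))⋯((xₙ))`, where `q` is a form over `F`, extended to `K`,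
and `π` is the generic `n`-fold Pfister form. -/
def genericMultiple (n : ℕ) {F : Type u} [Field F] [Invertible (2 : F)]
    {V : Type v} [AddCommGroup V] [Module F V] (q : QuadraticForm F V) :
    QuadraticForm (IterLaurent n F)
      ((IterLaurent n F ⊗[F] V) ⊗[IterLaurent n F] pfisterSpace (IterLaurent.vars n F)) :=
  (q.baseChange (IterLaurent n F)).tmul (genericPfister n F)

end

/-! The form `q ⊗ ⟨1, x₁⟩ ⊗ ⋯ ⊗ ⟨1, xₙ⟩` is the product of `q ⊗ ⟨1, x₁⟩`, which is anisotropic over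
`F((x₁))`, with the generic Pfister form in the remaining variables over that field. Induction on
`n` therefore reduces everything to one variable `x`.

Each nonzero element of `F((x))` is `c` or `cx` up to squares, with `c ∈ F` nonzero. If `φ` and `ψ`
are anisotropic over `F`, the leading terms of `φ` and `xψ` have valuations of different parity and
cannot cancel. Hence a constant form contained in `φ ⊥ xψ` is already contained in `φ`
(`exists_residue_linearMap`).

Every Pfister form over `F((x))` is `τ` or `τ ⊗ ⟨1, cx⟩` with `τ` a Pfister form over `F`
(`exists_pfisterForm_laurent`). A multiple of the first kind is `bτ` or `bxτ`, and cannot contain `q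
⊥ xq` unless `q = 0`. In the second kind, `q` lies in `bτ` or `bcτ`; halving both dimensions shows
that `q` is a neighbour of `τ`. The case `c = 1` is the descent half of (ii); the other half is
extension of scalars.

For (i), the descended `τ` is anisotropic because its neighbour `q` is (`IsNeighbour.anisotropic`,
which rests on the multiplicativity of Pfister forms), so (ii) applies to `τ`. -/

/-! ### Diagonal forms, their tensor products and scalar extensions. -/

section Diagonal

variable {F : Type u} [Field F]

/-- A form with an orthogonal basis is isometric to the diagonal form of its values there. -/
theorem equivalent_weightedSumSquares_of_basis [Invertible (2 : F)]
    {V : Type*} [AddCommGroup V] [Module F V] {ι : Type*} [Fintype ι]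
    (Q : QuadraticForm F V) (b : Module.Basis ι F V) (w : ι → F)
    (h : (QuadraticMap.associated (R := F) Q).IsOrthoᵢ b) (hw : ∀ i, Q (b i) = w i) :
    Q.Equivalent (QuadraticMap.weightedSumSquares F w) := by
  have e := Q.isometryEquivBasisRepr b
  rw [QuadraticMap.basisRepr_eq_of_iIsOrtho Q b h, funext hw] at e
  exact ⟨e⟩

theorem associated_weightedSumSquares_single [Invertible (2 : F)] {ι : Type*} [Fintype ι]
    [DecidableEq ι] (w : ι → F) (i j : ι) (hij : i ≠ j) :
    QuadraticMap.associated (R := F) (QuadraticMap.weightedSumSquares F w)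
      (Pi.single i 1) (Pi.single j 1) = 0 := by
  rw [QuadraticMap.associated_apply]
  simp only [QuadraticMap.weightedSumSquares_apply, ← Finset.sum_sub_distrib]
  rw [Finset.sum_eq_zero, smul_zero]
  intro k _
  by_cases hi : k = i <;> by_cases hj : k = j <;> simp_all

/-- A form isometric to a diagonal form has an orthogonal basis with the given values. -/
theorem exists_orthogonal_basis [Invertible (2 : F)]
    {V : Type*} [AddCommGroup V] [Module F V] {ι : Type*} [Fintype ι]
    {Q : QuadraticForm F V} {w : ι → F} (h : Q.Equivalent (QuadraticMap.weightedSumSquares F w)) :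
    ∃ b : Module.Basis ι F V,
      (QuadraticMap.associated (R := F) Q).IsOrthoᵢ b ∧ ∀ i, Q (b i) = w i := by
  classical
  obtain ⟨e⟩ := h
  refine ⟨(Pi.basisFun F ι).map e.symm.toLinearEquiv, ?_, fun i => ?_⟩
  · intro i j hij
    change QuadraticMap.associated (R := F) Q _ _ = 0
    have := associated_weightedSumSquares_single w i j hij
    rw [QuadraticMap.associated_apply] at this ⊢
    rw [← this]
    simp only [Module.Basis.map_apply, Pi.basisFun_apply, ← map_add]
    congr 2
    · congr 1
      · exact e.symm.map_app _
      · exact e.symm.map_app _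
    · exact e.symm.map_app _
  · simp only [Module.Basis.map_apply, Pi.basisFun_apply]
    refine (e.symm.map_app _).trans ?_
    simp [QuadraticMap.weightedSumSquares_apply, Pi.single_apply]

theorem tmul_equivalent_weightedSumSquares [Invertible (2 : F)]
    {V W : Type*} [AddCommGroup V] [Module F V] [AddCommGroup W] [Module F W]
    {ι κ : Type*} [Fintype ι] [Fintype κ] {Q : QuadraticForm F V} {P : QuadraticForm F W}
    {w : ι → F} {p : κ → F} (hQ : Q.Equivalent (QuadraticMap.weightedSumSquares F w))
    (hP : P.Equivalent (QuadraticMap.weightedSumSquares F p)) :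
    (Q.tmul P).Equivalent (QuadraticMap.weightedSumSquares F fun i : ι × κ => w i.1 * p i.2) := by
  obtain ⟨b, hb, hbw⟩ := exists_orthogonal_basis hQ
  obtain ⟨c, hc, hcp⟩ := exists_orthogonal_basis hP
  refine equivalent_weightedSumSquares_of_basis _ (b.tensorProduct c) _ ?_ ?_
  · rintro ⟨i, k⟩ ⟨j, l⟩ hij
    change QuadraticMap.associated (R := F) (Q.tmul P) _ _ = 0
    rw [QuadraticForm.associated_tmul]
    simp only [Module.Basis.tensorProduct_apply, LinearMap.BilinForm.tensorDistrib_tmul,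
      LinearMap.BilinForm.tmul]
    by_cases h : i = j
    · have hkl : k ≠ l := fun h' => hij (by rw [h, h'])
      have := hc hkl
      change QuadraticMap.associated (R := F) P _ _ = 0 at this
      rw [this, zero_smul]
    · have := hb h
      change QuadraticMap.associated (R := F) Q _ _ = 0 at this
      rw [this, smul_zero]
  · rintro ⟨i, k⟩
    simp [hbw, hcp, mul_comm]

theorem baseChange_equivalent_weightedSumSquares [Invertible (2 : F)]
    (E : Type*) [Field E] [Algebra F E] [Invertible (2 : E)]
    {V : Type*} [AddCommGroup V] [Module F V]
    {ι : Type*} [Fintype ι] {Q : QuadraticForm F V}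
    {w : ι → F} (hQ : Q.Equivalent (QuadraticMap.weightedSumSquares F w)) :
    (Q.baseChange E).Equivalent
      (QuadraticMap.weightedSumSquares E fun i => algebraMap F E (w i)) := by
  obtain ⟨b, hb, hbw⟩ := exists_orthogonal_basis hQ
  refine equivalent_weightedSumSquares_of_basis _ (b.baseChange E) _ ?_ ?_
  · intro i j hij
    change QuadraticMap.associated (R := E) (Q.baseChange E) _ _ = 0
    have := hb hij
    change QuadraticMap.associated (R := F) Q _ _ = 0 at this
    rw [QuadraticForm.associated_baseChange]
    simp [this]
  · intro i
    simp [hbw, Algebra.smul_def]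

theorem sq_equivalent_weightedSumSquares :
    (QuadraticMap.sq (R := F)).Equivalent
      (QuadraticMap.weightedSumSquares F fun _ : Unit => (1 : F)) :=
  ⟨{ (LinearEquiv.funUnique Unit F F).symm with
      map_app' := fun m => by simp [QuadraticMap.weightedSumSquares_apply] }⟩

/-- Reindexing a diagonal form. -/
theorem weightedSumSquares_reindex {ι κ : Type*} [Fintype ι] [Fintype κ] (e : ι ≃ κ)
    {w : ι → F} {p : κ → F} (h : ∀ i, p (e i) = w i) :
    (QuadraticMap.weightedSumSquares F w).Equivalent (QuadraticMap.weightedSumSquares F p) :=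
  ⟨{ LinearEquiv.funCongrLeft F F e.symm with
      map_app' := fun m => by
        simp only [QuadraticMap.weightedSumSquares_apply]
        exact (Fintype.sum_equiv e _ _ fun i => by simp [h, LinearEquiv.funCongrLeft]).symm }⟩

theorem QuadraticMap.Equivalent.anisotropic {V W : Type*} [AddCommGroup V] [Module F V]
    [AddCommGroup W] [Module F W] {Q : QuadraticForm F V} {P : QuadraticForm F W}
    (h : Q.Equivalent P) (hQ : Q.Anisotropic) : P.Anisotropic := by
  obtain ⟨e⟩ := h
  intro x hx
  have := hQ (e.symm x) ((e.symm.map_app x).trans hx)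
  simpa using congrArg e this

theorem QuadraticMap.Equivalent.finrank_eq {V W : Type*} [AddCommMonoid V] [Module F V]
    [AddCommMonoid W] [Module F W] {Q : QuadraticForm F V} {P : QuadraticForm F W}
    (h : Q.Equivalent P) : Module.finrank F V = Module.finrank F W :=
  h.some.toLinearEquiv.finrank_eq

theorem QuadraticMap.Equivalent.const_smul {V W : Type*} [AddCommMonoid V] [Module F V]
    [AddCommMonoid W] [Module F W] {Q : QuadraticForm F V} {P : QuadraticForm F W} (a : F)
    (h : Q.Equivalent P) : (a • Q).Equivalent (a • P) := by
  obtain ⟨e⟩ := h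
  exact ⟨{ e.toLinearEquiv with
    map_app' := fun m => congrArg (a * ·) (e.map_app m) }⟩

end Diagonal

/-! ### Pfister forms by repeated doubling, and isometries between them. -/

section Double

variable {F : Type u} [Field F]

/-- The form `⟨1, a⟩ ⊗ Q`, realised as `Q(x) + a Q(y)` on pairs. -/
def doubleForm {V : Type*} [AddCommGroup V] [Module F V] (Q : QuadraticForm F V) (a : F) :
    QuadraticForm F (V × V) :=
  Q.prod (a • Q)

@[simp]
theorem doubleForm_apply {V : Type*} [AddCommGroup V] [Module F V] (Q : QuadraticForm F V) (a : F)
    (x : V × V) : doubleForm Q a x = Q x.1 + a * Q x.2 := rfl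

theorem doubleForm_congr {V W : Type*} [AddCommGroup V] [Module F V]
    [AddCommGroup W] [Module F W] {Q : QuadraticForm F V} {P : QuadraticForm F W}
    (h : Q.Equivalent P) (a : F) : (doubleForm Q a).Equivalent (doubleForm P a) :=
  h.prod (h.const_smul a)

theorem doubleForm_weightedSumSquares {ι : Type*} [Fintype ι] (w : ι → F) (a : F) :
    (QuadraticMap.weightedSumSquares F fun i : ι × Fin 2 => w i.1 * ![1, a] i.2).Equivalent
      (doubleForm (QuadraticMap.weightedSumSquares F w) a) :=
  ⟨{ toFun := fun f => (fun i => f (i, 0), fun i => f (i, 1))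
     invFun := fun p k => ![p.1 k.1, p.2 k.1] k.2
     map_add' := fun f g => rfl
     map_smul' := fun c f => rfl
     left_inv := fun f => by
       ext ⟨i, k⟩
       fin_cases k <;> rfl
     right_inv := fun p => rfl
     map_app' := fun f => by
       simp only [doubleForm_apply, QuadraticMap.weightedSumSquares_apply, Fintype.sum_prod_type,
         Fin.sum_univ_two, Finset.sum_add_distrib, Finset.mul_sum]
       simp [mul_comm, mul_assoc] }⟩

/-- Replaces the tensor product by pairs of vectors, so that later isometries of Pfister forms can
be written down explicitly. -/
theorem oneForm_tmul_equivalent [Invertible (2 : F)] {V : Type*} [AddCommGroup V] [Module F V]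
    [FiniteDimensional F V] (Q : QuadraticForm F V) (a : F) :
    ((oneForm a).tmul Q).Equivalent (doubleForm Q a) := by
  obtain ⟨w, hw⟩ := Q.equivalent_weightedSumSquares
  refine (tmul_equivalent_weightedSumSquares (QuadraticMap.Equivalent.refl _) hw).trans ?_
  refine (weightedSumSquares_reindex (Equiv.prodComm _ _) fun i => ?_).trans
    ((doubleForm_weightedSumSquares w a).trans (doubleForm_congr hw.symm a))
  simp [mul_comm]

instance pfisterSpace_finite [Invertible (2 : F)] :
    (l : List F) → FiniteDimensional F (pfisterSpace l)
  | [] => inferInstanceAs (FiniteDimensional F F)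
  | _ :: l =>
    have := pfisterSpace_finite l
    inferInstanceAs (FiniteDimensional F ((Fin 2 → F) ⊗[F] pfisterSpace l))

variable [Invertible (2 : F)]

theorem pfisterForm_nil :
    (pfisterForm ([] : List F)).Equivalent (QuadraticMap.sq (R := F)) :=
  QuadraticMap.Equivalent.refl (pfisterForm ([] : List F))

theorem pfisterForm_cons (a : F) (l : List F) :
    (pfisterForm (a :: l)).Equivalent (doubleForm (pfisterForm l) a) :=
  oneForm_tmul_equivalent (pfisterForm l) a

theorem pfisterForm_cons_congr (a : F) {l l' : List F}
    (h : (pfisterForm l).Equivalent (pfisterForm l')) :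
    (pfisterForm (a :: l)).Equivalent (pfisterForm (a :: l')) :=
  (pfisterForm_cons a l).trans ((doubleForm_congr h a).trans (pfisterForm_cons a l').symm)

theorem pfisterForm_cons_mul_sq (a : F) {s : F} (hs : s ≠ 0) (l : List F) :
    (pfisterForm (s * s * a :: l)).Equivalent (pfisterForm (a :: l)) := by
  refine (pfisterForm_cons _ l).trans (QuadraticMap.Equivalent.trans ?_ (pfisterForm_cons a l).symm)
  exact ⟨{ LinearEquiv.prodCongr (LinearEquiv.refl F _) (LinearEquiv.smulOfNeZero F _ s hs) with
    map_app' := fun m => by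
      simp [QuadraticMap.map_smul]
      ring }⟩

theorem pfisterForm_swap (a b : F) (l : List F) :
    (pfisterForm (a :: b :: l)).Equivalent (pfisterForm (b :: a :: l)) := by
  refine (pfisterForm_cons a _).trans ((doubleForm_congr (pfisterForm_cons b l) a).trans ?_)
  refine QuadraticMap.Equivalent.trans ?_
    ((pfisterForm_cons b _).trans (doubleForm_congr (pfisterForm_cons a l) b)).symm
  exact ⟨{ LinearEquiv.prodProdProdComm F _ _ _ _ with
    map_app' := fun m => by
      simp
      ring }⟩

/-- Compare `⟨1, a, b, ab⟩` with `⟨1, a, ab, a²b⟩`: the entries agree up to order and the square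
`a²`. -/
theorem pfisterForm_cons_cons_mul {a : F} (ha : a ≠ 0) (b : F) (l : List F) :
    (pfisterForm (a :: b :: l)).Equivalent (pfisterForm (a :: a * b :: l)) := by
  refine (pfisterForm_cons a _).trans ((doubleForm_congr (pfisterForm_cons b l) a).trans ?_)
  refine QuadraticMap.Equivalent.trans ?_
    ((pfisterForm_cons a _).trans (doubleForm_congr (pfisterForm_cons (a * b) l) a)).symm
  exact ⟨{
    toFun := fun p => ((p.1.1, p.2.2), (p.2.1, a⁻¹ • p.1.2))
    invFun := fun p => ((p.1.1, a • p.2.2), (p.2.1, p.1.2))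
    map_add' := fun f g => by simp
    map_smul' := fun c f => by simp [smul_comm c]
    left_inv := fun f => by simp [ha]
    right_inv := fun f => by simp [ha]
    map_app' := fun m => by
      simp [QuadraticMap.map_smul]
      field_simp
      ring }⟩

end Double

/-! ### Multiplicativity of Pfister forms, and the isotropic case. -/

section Round

variable {F : Type u} [Field F]

/-- Every nonzero value of `Q` is a similarity factor of `Q`. -/
def IsRound {V : Type*} [AddCommGroup V] [Module F V] (Q : QuadraticForm F V) : Prop :=
  ∀ x, Q x ≠ 0 → ∃ f : V →ₗ[F] V, ∀ y, Q (f y) = Q x * Q y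

theorem IsRound.of_equivalent {V W : Type*} [AddCommGroup V] [Module F V]
    [AddCommGroup W] [Module F W] {Q : QuadraticForm F V} {P : QuadraticForm F W}
    (h : Q.Equivalent P) (hP : IsRound P) : IsRound Q := by
  obtain ⟨e⟩ := h
  intro x hx
  obtain ⟨f, hf⟩ := hP (e x) (by rwa [e.map_app])
  refine ⟨e.symm.toLinearEquiv.toLinearMap ∘ₗ f ∘ₗ e.toLinearEquiv.toLinearMap, fun y => ?_⟩
  refine (e.symm.map_app _).trans ((hf _).trans ?_)
  rw [e.map_app]
  exact congrArg _ (e.map_app y)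

theorem IsRound.doubleForm {V : Type*} [AddCommGroup V] [Module F V] {Q : QuadraticForm F V}
    (hQ : IsRound Q) (a : F) : IsRound (doubleForm Q a) := by
  rintro ⟨x, y⟩ hxy
  rw [doubleForm_apply] at hxy ⊢
  dsimp only at hxy ⊢
  by_cases hx : Q x = 0
  · have hy : Q y ≠ 0 := fun h => hxy (by rw [hx, h]; ring)
    obtain ⟨f, hf⟩ := hQ y hy
    refine ⟨((a • f) ∘ₗ LinearMap.snd F V V).prod (f ∘ₗ LinearMap.fst F V V), fun z => ?_⟩
    simp [QuadraticMap.map_smul, hf, hx]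
    ring
  obtain ⟨f, hf⟩ := hQ x hx
  by_cases hy : Q y = 0
  · refine ⟨f.prodMap f, fun z => ?_⟩
    simp [hf, hy]
    ring
  obtain ⟨g, hg⟩ := hQ y hy
  -- Put `u = Q x`, `v = Q y`. With `t = (uv)⁻¹ f(g(z₂))`, so that `Q t = (uv)⁻¹ Q z₂`, the map is
  -- `z ↦ (f(z₁ - av t), g(z₁ + u t))`. In `u Q(z₁ - av t) + av Q(z₁ + u t)` the polar terms cancel,
  -- leaving `(u + av)(Q z₁ + a Q z₂)`.
  refine ⟨(f ∘ₗ (LinearMap.fst F V V - (a * Q y) • (((Q x)⁻¹ * (Q y)⁻¹) • (f ∘ₗ g)) ∘ₗ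
      LinearMap.snd F V V)).prod (g ∘ₗ (LinearMap.fst F V V + (Q x) •
      (((Q x)⁻¹ * (Q y)⁻¹) • (f ∘ₗ g)) ∘ₗ LinearMap.snd F V V)), fun z => ?_⟩
  have key : ∀ (c : F) (p q : V), Q (p + c • q) = Q p + c * c * Q q + c * QuadraticMap.polar Q p q := by
    intro c p q
    rw [QuadraticMap.map_add Q p, QuadraticMap.polar_smul_right, QuadraticMap.map_smul]
    simp [smul_eq_mul]
  set t : V := ((Q x)⁻¹ * (Q y)⁻¹) • f (g z.2) with ht
  have hQt : Q t = (Q x)⁻¹ * (Q y)⁻¹ * Q z.2 := by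
    rw [ht, QuadraticMap.map_smul, hf, hg, smul_eq_mul]
    field_simp
  have e1 : z.1 - (a * Q y) • t = z.1 + (-(a * Q y)) • t := by rw [neg_smul, sub_eq_add_neg]
  simp only [doubleForm_apply, LinearMap.prod_apply, Function.prod, LinearMap.comp_apply,
    LinearMap.sub_apply, LinearMap.add_apply, LinearMap.smul_apply, LinearMap.fst_apply,
    LinearMap.snd_apply, hf, hg, ← ht]
  rw [e1, key, key, hQt]
  field_simp
  ring

theorem isRound_pfisterForm [Invertible (2 : F)] (l : List F) : IsRound (pfisterForm l) := by
  induction l with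
  | nil =>
    refine IsRound.of_equivalent pfisterForm_nil fun x _ => ⟨LinearMap.mulLeft F x, fun y => ?_⟩
    simp only [QuadraticMap.sq_apply, LinearMap.mulLeft_apply]
    ring
  | cons a l ih => exact (ih.doubleForm a).of_equivalent (pfisterForm_cons a l)

/-- An isotropic Pfister form vanishes on a subspace of half the dimension. -/
theorem exists_totally_isotropic_of_pfisterForm [Invertible (2 : F)] (l : List F)
    (h : ¬ (pfisterForm l).Anisotropic) :
    ∃ U : Submodule F (pfisterSpace l), (∀ x ∈ U, pfisterForm l x = 0) ∧
      2 * Module.finrank F U = Module.finrank F (pfisterSpace l) := by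
  induction l with
  | nil =>
    exact absurd (pfisterForm_nil.symm.anisotropic fun x hx => mul_self_eq_zero.mp hx) h
  | cons a l ih =>
    suffices H : ∃ U : Submodule F (pfisterSpace l × pfisterSpace l),
        (∀ x ∈ U, doubleForm (pfisterForm l) a x = 0) ∧
          Module.finrank F U = Module.finrank F (pfisterSpace l) by
      obtain ⟨e⟩ := pfisterForm_cons a l
      obtain ⟨U, hU, hd⟩ := H
      refine ⟨U.map (e.symm.toLinearEquiv : _ →ₗ[F] _), ?_, ?_⟩
      · rintro _ ⟨x, hx, rfl⟩
        exact (e.symm.map_app x).trans (hU x hx)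
      · rw [LinearEquiv.finrank_map_eq e.symm.toLinearEquiv U, e.toLinearEquiv.finrank_eq,
          Module.finrank_prod, hd, two_mul]
    by_cases hl : (pfisterForm l).Anisotropic
    · have h2 : ¬ (doubleForm (pfisterForm l) a).Anisotropic := fun h' =>
        h ((pfisterForm_cons a l).symm.anisotropic h')
      obtain ⟨⟨x, y⟩, hne, h0⟩ := (QuadraticMap.not_anisotropic_iff_exists _).mp h2
      rw [doubleForm_apply] at h0
      dsimp only at h0
      have hy : pfisterForm l y ≠ 0 := by
        intro hy
        rw [hy, mul_zero, add_zero] at h0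
        exact hne (Prod.ext (hl x h0) (hl y hy))
      -- Here `-a` is the quotient of the values at `x` and `y`, hence a similarity factor; the
      -- graph of such a similarity is totally isotropic. Entries of the list may vanish, and for `a
      -- = 0` the zero map serves.
      have hsim : ∃ f : pfisterSpace l →ₗ[F] pfisterSpace l,
          ∀ z, pfisterForm l (f z) = -a * pfisterForm l z := by
        by_cases hx : pfisterForm l x = 0
        · refine ⟨0, fun z => ?_⟩
          have : a = 0 := by
            rw [hx, zero_add] at h0
            exact (mul_eq_zero.mp h0).resolve_right hy
          simp [this]
        obtain ⟨f, hf⟩ := isRound_pfisterForm l x hx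
        obtain ⟨g, hg⟩ := isRound_pfisterForm l y hy
        refine ⟨(pfisterForm l y)⁻¹ • (f ∘ₗ g), fun z => ?_⟩
        have hx' : pfisterForm l x = -a * pfisterForm l y := by linear_combination h0
        rw [LinearMap.smul_apply, LinearMap.comp_apply, QuadraticMap.map_smul, hf, hg, hx',
          smul_eq_mul]
        field_simp
      obtain ⟨f, hf⟩ := hsim
      refine ⟨LinearMap.range (f.prod LinearMap.id), ?_, ?_⟩
      · rintro _ ⟨z, rfl⟩
        simp [hf]
      · refine LinearMap.finrank_range_of_inj fun z z' hz => ?_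
        simpa using congrArg Prod.snd hz
    · obtain ⟨U, hU, hd⟩ := ih hl
      refine ⟨U.prod U, ?_, ?_⟩
      · rintro ⟨x, y⟩ ⟨hx, hy⟩
        simp [hU x hx, hU y hy]
      · have e : (U.prod U) ≃ₗ[F] U × U :=
          { toFun := fun z => (⟨z.1.1, z.2.1⟩, ⟨z.1.2, z.2.2⟩)
            invFun := fun z => ⟨(z.1.1, z.2.1), z.1.2, z.2.2⟩
            map_add' := fun _ _ => rfl
            map_smul' := fun _ _ => rfl
            left_inv := fun _ => rfl
            right_inv := fun _ => rfl }
        rw [← hd, e.finrank_eq, Module.finrank_prod, two_mul]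

end Round

/-! ### Subforms, neighbours and anisotropy. -/

section Subform

variable {F : Type u} [Field F]

theorem IsSubform.exists_linearMap {V W : Type*} [AddCommMonoid V] [Module F V]
    [AddCommMonoid W] [Module F W] {p : QuadraticForm F V} {q : QuadraticForm F W}
    (h : IsSubform p q) : ∃ f : V →ₗ[F] W, ∀ x, q (f x) = p x := by
  obtain ⟨k, r, -, ⟨e⟩⟩ := h
  refine ⟨e.symm.toLinearEquiv.toLinearMap ∘ₗ LinearMap.inl F V _, fun x => ?_⟩
  exact (e.symm.map_app _).trans (by simp)

theorem QuadraticMap.Anisotropic.nondegenerate [Invertible (2 : F)] {V : Type*} [AddCommGroup V]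
    [Module F V] {q : QuadraticForm F V} (hq : q.Anisotropic) : q.Nondegenerate := by
  rw [QuadraticMap.nondegenerate_iff_radical_eq_bot, eq_bot_iff]
  intro x hx
  exact hq x (QuadraticMap.mem_radical_iff'.mp hx).1

/-- Anisotropy of `q` makes the image of `f` meet its orthogonal complement trivially, so the image
splits off. Between anisotropic forms, containment thus amounts to a value-preserving linear map. -/
theorem isSubform_of_linearMap [Invertible (2 : F)] {V W : Type*} [AddCommGroup V] [Module F V]
    [AddCommGroup W] [Module F W] [FiniteDimensional F W]
    {p : QuadraticForm F V} {q : QuadraticForm F W} (hq : q.Anisotropic) (hp : p.Anisotropic)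
    (f : V →ₗ[F] W) (hf : ∀ x, q (f x) = p x) : IsSubform p q := by
  set B : LinearMap.BilinForm F W := QuadraticMap.associated (R := F) q with hB
  have hBq : ∀ x, B x x = q x := fun x => QuadraticMap.associated_eq_self_apply F q x
  have hsymm : ∀ x y, B x y = B y x := fun x y =>
    (QuadraticMap.associated_isSymm F q) x y
  have hrefl : LinearMap.BilinForm.IsRefl B := fun x y h => by rw [hsymm, h]
  have hinj : Function.Injective f := by
    refine (injective_iff_map_eq_zero f).mpr fun x hx => hp x ?_
    rw [← hf, hx, QuadraticMap.map_zero]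
  have hc : IsCompl (LinearMap.range f) (LinearMap.BilinForm.orthogonal B (LinearMap.range f)) := by
    rw [LinearMap.BilinForm.isCompl_orthogonal_iff_disjoint hrefl, Submodule.disjoint_def]
    intro x hx hx'
    exact hq x (by rw [← hBq]; exact hx' x hx)
  set U := LinearMap.BilinForm.orthogonal B (LinearMap.range f) with hU
  set b := Module.finBasis F U
  have hqU : (q.comp U.subtype).Anisotropic := fun x hx => Subtype.ext (hq x hx)
  refine ⟨Module.finrank F U, (q.comp U.subtype).comp b.equivFun.symm.toLinearMap, ?_, ?_⟩
  · refine QuadraticMap.Anisotropic.nondegenerate fun x hx => ?_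
    exact b.equivFun.symm.map_eq_zero_iff.mp (hqU _ hx)
  · refine QuadraticMap.Equivalent.symm ⟨{
      (LinearEquiv.prodCongr (LinearEquiv.ofInjective f hinj) b.equivFun.symm).trans
        (Submodule.prodEquivOfIsCompl _ _ hc) with
      map_app' := ?_ }⟩
    rintro ⟨x, y⟩
    have h0 : B (f x) (b.equivFun.symm y : W) = 0 :=
      (b.equivFun.symm y).2 (f x) ⟨x, rfl⟩
    have h1 : q (f x + (b.equivFun.symm y : W)) = q (f x) + q (b.equivFun.symm y : W) := by
      rw [← hBq, ← hBq, ← hBq]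
      simp only [map_add, LinearMap.add_apply]
      rw [hsymm (b.equivFun.symm y : W) (f x), h0]
      ring
    refine h1.trans ?_
    rw [hf]
    rfl

theorem IsSubform.of_equivalent {V V' W W' : Type*}
    [AddCommMonoid V] [Module F V] [AddCommMonoid V'] [Module F V']
    [AddCommMonoid W] [Module F W] [AddCommMonoid W'] [Module F W']
    {p : QuadraticForm F V} {p' : QuadraticForm F V'} {q : QuadraticForm F W}
    {q' : QuadraticForm F W'} (hp : p.Equivalent p') (hq : q.Equivalent q')
    (h : IsSubform p q) : IsSubform p' q' := by
  obtain ⟨k, r, hr, e⟩ := h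
  exact ⟨k, r, hr, hq.symm.trans (e.trans (hp.prod (QuadraticMap.Equivalent.refl r)))⟩

variable [Invertible (2 : F)]

theorem IsPfister.of_equivalent {V : Type*} {W : Type*} [AddCommMonoid V] [Module F V]
    [AddCommMonoid W] [Module F W] {Q : QuadraticForm F V} {P : QuadraticForm F W}
    (h : Q.Equivalent P) (hP : IsPfister P) : IsPfister Q := by
  obtain ⟨l, hl, e⟩ := hP
  exact ⟨l, hl, h.trans e⟩

theorem IsNeighbour.of_equivalent {V V' W W' : Type*}
    [AddCommMonoid V] [Module F V] [AddCommMonoid V'] [Module F V']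
    [AddCommMonoid W] [Module F W] [AddCommMonoid W'] [Module F W']
    {p : QuadraticForm F V} {p' : QuadraticForm F V'} {q : QuadraticForm F W}
    {q' : QuadraticForm F W'} (hp : p.Equivalent p') (hq : q.Equivalent q')
    (h : IsNeighbour p q) : IsNeighbour p' q' := by
  obtain ⟨h1, ⟨a, ha, h2⟩, h3⟩ := h
  refine ⟨h1.of_equivalent hq.symm, ⟨a, ha, h2.of_equivalent hp (hq.const_smul a)⟩, ?_⟩
  rwa [← hp.finrank_eq, ← hq.finrank_eq]

theorem isNeighbour_congr {V V' W W' : Type*}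
    [AddCommMonoid V] [Module F V] [AddCommMonoid V'] [Module F V']
    [AddCommMonoid W] [Module F W] [AddCommMonoid W'] [Module F W']
    {p : QuadraticForm F V} {p' : QuadraticForm F V'} {q : QuadraticForm F W}
    {q' : QuadraticForm F W'} (hp : p.Equivalent p') (hq : q.Equivalent q') :
    IsNeighbour p q ↔ IsNeighbour p' q' :=
  ⟨IsNeighbour.of_equivalent hp hq, IsNeighbour.of_equivalent hp.symm hq.symm⟩

/-- The Pfister form of an anisotropic neighbour is anisotropic. -/
theorem IsNeighbour.anisotropic {V W : Type*} [AddCommGroup V] [Module F V]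
    [FiniteDimensional F V] [AddCommGroup W] [Module F W]
    {p : QuadraticForm F V} {q : QuadraticForm F W} (h : IsNeighbour p q) (hp : p.Anisotropic) :
    q.Anisotropic := by
  obtain ⟨l, hl, e⟩ := h.1
  obtain ⟨-, ⟨a, ha, hs⟩, hd⟩ := h.of_equivalent (QuadraticMap.Equivalent.refl p) e
  refine e.symm.anisotropic ?_
  by_contra hani
  obtain ⟨U, hU, hUd⟩ := exists_totally_isotropic_of_pfisterForm l hani
  obtain ⟨f, hf⟩ := hs.exists_linearMap
  have hinj : Function.Injective f := by
    refine (injective_iff_map_eq_zero f).mpr fun x hx => hp x ?_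
    rw [← hf, hx, QuadraticMap.map_zero]
  -- The image of `p` has more than half the dimension, so it would have to meet the totally
  -- isotropic `U`.
  have hdis : Disjoint (LinearMap.range f) U := by
    rw [Submodule.disjoint_def]
    rintro _ ⟨x, rfl⟩ hx
    have : p x = 0 := by
      rw [← hf]
      change a * pfisterForm l (f x) = 0
      rw [hU _ hx, mul_zero]
    rw [hp x this, map_zero]
  have := Submodule.finrank_add_finrank_le_of_disjoint hdis
  rw [LinearMap.finrank_range_of_inj hinj] at this
  omega

end Subform

/-! ### Square classes, leading coefficients and residues over `F((x))`. -/

section Laurent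

variable {F : Type u} [Field F]

/-- Hensel's lemma for `T² - p` at the approximate root `1`, where the derivative `2` is a unit. -/
theorem PowerSeries.isSquare_of_constantCoeff_eq_one [Invertible (2 : F)] {p : PowerSeries F}
    (hp : PowerSeries.constantCoeff p = 1) : ∃ t : PowerSeries F, p = t * t := by
  have h := HenselianRing.is_henselian (I := Ideal.span {(PowerSeries.X : PowerSeries F)})
    (Polynomial.X ^ 2 - Polynomial.C p) (Polynomial.monic_X_pow_sub_C p two_ne_zero) 1
    (by
      rw [Ideal.mem_span_singleton, PowerSeries.X_dvd_iff]
      simp [hp])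
    (by
      refine IsUnit.map _ ?_
      rw [PowerSeries.isUnit_iff_constantCoeff]
      have h2 : PowerSeries.constantCoeff (2 : PowerSeries F) = 2 := map_ofNat _ 2
      simpa [one_add_one_eq_two, h2] using (isUnit_of_invertible (2 : F)).ne_zero)
  obtain ⟨t, ht, -⟩ := h
  refine ⟨t, ?_⟩
  have : t ^ 2 - p = 0 := by simpa [Polynomial.IsRoot] using ht
  linear_combination -this

/-- Square classes of `F((x))`. -/
theorem LaurentSeries.exists_eq_mul_self_mul [Invertible (2 : F)] {a : LaurentSeries F}
    (ha : a ≠ 0) : ∃ (s : LaurentSeries F) (c : F), s ≠ 0 ∧ c ≠ 0 ∧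
      (a = s * s * HahnSeries.C c ∨
        a = s * s * (HahnSeries.single (1 : ℤ) (1 : F) * HahnSeries.C c)) := by
  set p := a.powerSeriesPart with hp
  have hc : PowerSeries.constantCoeff p ≠ 0 := by
    rw [← PowerSeries.coeff_zero_eq_constantCoeff_apply, hp, LaurentSeries.powerSeriesPart_coeff]
    simpa [HahnSeries.coeff_order_eq_zero] using ha
  set c := PowerSeries.constantCoeff p
  obtain ⟨t, ht⟩ := PowerSeries.isSquare_of_constantCoeff_eq_one
    (p := PowerSeries.C c⁻¹ * p) (by simp [hc, c])
  have hpt : p = PowerSeries.C c * (t * t) := by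
    rw [← ht, ← mul_assoc, ← map_mul, mul_inv_cancel₀ hc, map_one, one_mul]
  have hmain : a = HahnSeries.single a.order 1 * (HahnSeries.C c *
      ((t : LaurentSeries F) * (t : LaurentSeries F))) := by
    rw [← PowerSeries.coe_C, ← PowerSeries.coe_mul, ← PowerSeries.coe_mul, ← hpt]
    exact (LaurentSeries.single_order_mul_powerSeriesPart a).symm
  have hsq (k : ℤ) : HahnSeries.single (k + k) (1 : F) =
      HahnSeries.single k (1 : F) * HahnSeries.single k (1 : F) := by simp
  -- Half of the order, rounded down, goes into the square; its parity decides between the classes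
  -- `c` and `cx`.
  refine ⟨HahnSeries.single (a.order / 2) 1 * (t : LaurentSeries F), c, ?_, hc, ?_⟩
  · intro h0
    have ht0 : (t : LaurentSeries F) = 0 := by
      simpa using h0
    rw [ht0, mul_zero, mul_zero, mul_zero] at hmain
    exact ha hmain
  · rcases Int.even_or_odd' a.order with ⟨k, hk | hk⟩
    · left
      have : a.order / 2 = k := by omega
      rw [this]
      conv_lhs => rw [hmain, hk, two_mul, hsq]
      ring
    · right
      have : a.order / 2 = k := by omega
      rw [this]
      have h1 : HahnSeries.single (k + k + 1) (1 : F) =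
        HahnSeries.single (k + k) (1 : F) * HahnSeries.single 1 (1 : F) := by simp
      conv_lhs => rw [hmain, hk, two_mul, h1, hsq]
      ring

/-- The diagonal form with weights `w` over `F`, extended to `F((x))`. -/
noncomputable def laurentForm {ι : Type*} [Fintype ι] (w : ι → F) :
    QuadraticForm (LaurentSeries F) (ι → LaurentSeries F) :=
  QuadraticMap.weightedSumSquares (LaurentSeries F) fun i => (HahnSeries.C (w i) : LaurentSeries F)

theorem laurentForm_apply {ι : Type*} [Fintype ι] (w : ι → F) (f : ι → LaurentSeries F) :
    laurentForm w f = ∑ i, HahnSeries.C (w i) * (f i * f i) := by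
  simp [laurentForm, QuadraticMap.weightedSumSquares_apply]

theorem laurentForm_C {ι : Type*} [Fintype ι] (w : ι → F) (z : ι → F) :
    laurentForm w (fun i => HahnSeries.C (z i)) =
      HahnSeries.C (QuadraticMap.weightedSumSquares F w z) := by
  simp [laurentForm_apply, QuadraticMap.weightedSumSquares_apply]

theorem laurentForm_const_mul {ι : Type*} [Fintype ι] (b : F) (w : ι → F)
    (f : ι → LaurentSeries F) :
    laurentForm (fun i => b * w i) f = HahnSeries.C b * laurentForm w f := by
  simp [laurentForm_apply, Finset.mul_sum, mul_smul]

theorem weightedSumSquares_const_mul {ι : Type*} [Fintype ι] (b : F) (w : ι → F) (z : ι → F) :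
    QuadraticMap.weightedSumSquares F (fun i => b * w i) z =
      b * QuadraticMap.weightedSumSquares F w z := by
  simp [QuadraticMap.weightedSumSquares_apply, Finset.mul_sum, mul_assoc]

theorem weightedSumSquares_const_mul_anisotropic {ι : Type*} [Fintype ι] {b : F} (hb : b ≠ 0)
    {w : ι → F} (hw : (QuadraticMap.weightedSumSquares F w).Anisotropic) :
    (QuadraticMap.weightedSumSquares F fun i => b * w i).Anisotropic := fun z hz => hw z <| by
  rw [weightedSumSquares_const_mul] at hz
  exact (mul_eq_zero.mp hz).resolve_left hb

theorem LaurentSeries.coeff_mul_self_of_lt {a : LaurentSeries F} {N : ℤ}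
    (h : ∀ m < N, a.coeff m = 0) {m : ℤ} (hm : m < 2 * N) : (a * a).coeff m = 0 := by
  rw [HahnSeries.coeff_mul]
  refine Finset.sum_eq_zero fun ij hij => ?_
  have hs := (Finset.mem_antidiagonal.mp hij).2.2
  rcases lt_or_ge ij.1 N with h1 | h1
  · rw [h _ h1, zero_mul]
  · rw [h ij.2 (by omega), mul_zero]

theorem LaurentSeries.coeff_mul_self_two_mul {a : LaurentSeries F} {N : ℤ}
    (h : ∀ m < N, a.coeff m = 0) : (a * a).coeff (2 * N) = a.coeff N * a.coeff N := by
  by_cases ha : a.coeff N = 0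
  · have : ∀ m < N + 1, a.coeff m = 0 := fun m hm => by
      rcases (Int.lt_add_one_iff.mp hm).lt_or_eq with h' | h'
      · exact h m h'
      · rw [h', ha]
    rw [LaurentSeries.coeff_mul_self_of_lt this (by omega), ha, zero_mul]
  rw [HahnSeries.coeff_mul]
  refine Finset.sum_eq_single_of_mem (N, N) ?_ fun ij hij hne => ?_
  · exact Finset.mem_antidiagonal.mpr ⟨ha, ha, by ring⟩
  have hs := (Finset.mem_antidiagonal.mp hij).2.2
  rcases lt_trichotomy ij.1 N with h1 | h1 | h1
  · rw [h _ h1, zero_mul]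
  · exact absurd (Prod.ext h1 (by dsimp only; omega)) hne
  · rw [h ij.2 (by omega), mul_zero]

theorem laurentForm_coeff_of_lt {ι : Type*} [Fintype ι] (w : ι → F) {f : ι → LaurentSeries F}
    {N : ℤ} (h : ∀ i, ∀ m < N, (f i).coeff m = 0) {m : ℤ} (hm : m < 2 * N) :
    (laurentForm w f).coeff m = 0 := by
  rw [laurentForm_apply, HahnSeries.coeff_sum]
  refine Finset.sum_eq_zero fun i _ => ?_
  rw [HahnSeries.C_mul_eq_smul, HahnSeries.coeff_smul,
    LaurentSeries.coeff_mul_self_of_lt (h i) hm, smul_zero]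

theorem laurentForm_coeff_two_mul {ι : Type*} [Fintype ι] (w : ι → F) {f : ι → LaurentSeries F}
    {N : ℤ} (h : ∀ i, ∀ m < N, (f i).coeff m = 0) :
    (laurentForm w f).coeff (2 * N) =
      QuadraticMap.weightedSumSquares F w fun i => (f i).coeff N := by
  rw [laurentForm_apply, HahnSeries.coeff_sum, QuadraticMap.weightedSumSquares_apply]
  refine Finset.sum_congr rfl fun i _ => ?_
  rw [HahnSeries.C_mul_eq_smul, HahnSeries.coeff_smul,
    LaurentSeries.coeff_mul_self_two_mul (h i)]

theorem LaurentSeries.exists_coeff_eq_zero_of_lt {ι : Type*} [Fintype ι]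
    (f : ι → LaurentSeries F) (B : ℤ) :
    ∃ N ≤ B, ∀ i, ∀ m < N, (f i).coeff m = 0 := by
  -- Minus the sum of the absolute values is a common lower bound for the orders, available even for
  -- an empty index type.
  refine ⟨min B (-∑ i, |(f i).order|), min_le_left _ _, fun i m hm => ?_⟩
  refine HahnSeries.coeff_eq_zero_of_lt_order (lt_of_lt_of_le hm (le_trans (min_le_right _ _) ?_))
  have := Finset.single_le_sum (fun j _ => abs_nonneg (f j).order) (Finset.mem_univ i)
  have := neg_abs_le (f i).order
  linarith

theorem LaurentSeries.coeff_eq_zero_of_lt_add_one {ι : Type*} {f : ι → LaurentSeries F} {N : ℤ}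
    (h : ∀ i, ∀ m < N, (f i).coeff m = 0) (hN : ∀ i, (f i).coeff N = 0) :
    ∀ i, ∀ m < N + 1, (f i).coeff m = 0 := by
  intro i m hm
  rcases (Int.lt_add_one_iff.mp hm).lt_or_eq with h' | h'
  · exact h i m h'
  · rw [h', hN]

section Residue

variable {κ κ' : Type*} [Fintype κ] [Fintype κ'] {r : κ → F} {r' : κ' → F}
  (hr : (QuadraticMap.weightedSumSquares F r).Anisotropic)
  (hr' : (QuadraticMap.weightedSumSquares F r').Anisotropic)

include hr hr'

/-- If `φ ⊥ xψ`, with `φ` and `ψ` anisotropic over `F`, takes a value of valuation at least `2B`,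
then the argument has valuation at least `B`. -/
theorem coeff_eq_zero_of_laurentForm_coeff_eq_zero
    {f : κ → LaurentSeries F} {g : κ' → LaurentSeries F} {B : ℤ}
    (h : ∀ m < 2 * B, (laurentForm r f +
      HahnSeries.single (1 : ℤ) (1 : F) * laurentForm r' g).coeff m = 0) :
    (∀ i, ∀ m < B, (f i).coeff m = 0) ∧ ∀ i, ∀ m < B, (g i).coeff m = 0 := by
  obtain ⟨N₁, hN₁, hf⟩ := LaurentSeries.exists_coeff_eq_zero_of_lt f B
  obtain ⟨N₂, hN₂, hg⟩ := LaurentSeries.exists_coeff_eq_zero_of_lt g B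
  suffices H : ∀ N, min N₁ N₂ ≤ N → N ≤ B →
      (∀ i, ∀ m < N, (f i).coeff m = 0) ∧ ∀ i, ∀ m < N, (g i).coeff m = 0 from
    H B ((min_le_left _ _).trans hN₁) le_rfl
  intro N hN
  induction N, hN using Int.leInduction with
  | base =>
    exact fun _ => ⟨fun i m hm => hf i m (lt_of_lt_of_le hm (min_le_left _ _)),
      fun i m hm => hg i m (lt_of_lt_of_le hm (min_le_right _ _))⟩
  | succ N hN ih =>
    intro hNB
    obtain ⟨hf, hg⟩ := ih (by omega)
    -- In degree `2N` only `φ` contributes, since `xψ` starts in degree `2N + 1`; once the entries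
    -- of `f` are improved, degree `2N + 1` sees only `ψ`.
    have hf' : ∀ i, (f i).coeff N = 0 := by
      have := h (2 * N) (by omega)
      rw [HahnSeries.coeff_add, HahnSeries.coeff_single_mul, one_mul,
        laurentForm_coeff_of_lt r' hg (by omega), add_zero, laurentForm_coeff_two_mul r hf] at this
      exact congrFun (hr _ this)
    have hf'' := LaurentSeries.coeff_eq_zero_of_lt_add_one hf hf'
    refine ⟨hf'', ?_⟩
    have := h (2 * N + 1) (by omega)
    rw [HahnSeries.coeff_add, HahnSeries.coeff_single_mul, one_mul,
      laurentForm_coeff_of_lt r hf'' (by omega), zero_add, add_sub_cancel_right,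
      laurentForm_coeff_two_mul r' hg] at this
    exact LaurentSeries.coeff_eq_zero_of_lt_add_one hg (congrFun (hr' _ this))

theorem eq_zero_of_laurentForm_add_eq_zero
    {f : κ → LaurentSeries F} {g : κ' → LaurentSeries F}
    (h : laurentForm r f + HahnSeries.single (1 : ℤ) (1 : F) * laurentForm r' g = 0) :
    f = 0 ∧ g = 0 := by
  have H (B : ℤ) := coeff_eq_zero_of_laurentForm_coeff_eq_zero hr hr' (f := f) (g := g) (B := B)
    fun m _ => by rw [h, HahnSeries.coeff_zero]
  constructor
  · ext i m
    exact (H (m + 1)).1 i m (by omega)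
  · ext i m
    exact (H (m + 1)).2 i m (by omega)

/-- A constant form contained in `φ ⊥ xψ`, with `φ` and `ψ` anisotropic over `F`, is contained
in `φ`. -/
theorem exists_residue_linearMap {ι : Type*} [Fintype ι] (w : ι → F)
    (f : (ι → LaurentSeries F) →ₗ[LaurentSeries F] (κ → LaurentSeries F))
    (g : (ι → LaurentSeries F) →ₗ[LaurentSeries F] (κ' → LaurentSeries F))
    (h : ∀ z, laurentForm r (f z) + HahnSeries.single (1 : ℤ) (1 : F) * laurentForm r' (g z) =
      laurentForm w z) :
    ∃ f₀ : (ι → F) →ₗ[F] (κ → F), ∀ z, QuadraticMap.weightedSumSquares F r (f₀ z) =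
      QuadraticMap.weightedSumSquares F w z := by
  have hadd (x y : ι → F) : (fun i => (HahnSeries.C ((x + y) i) : LaurentSeries F)) =
      (fun i => HahnSeries.C (x i)) + fun i => HahnSeries.C (y i) := by
    ext1 i; simp
  have hsmul (c : F) (x : ι → F) : (fun i => (HahnSeries.C ((c • x) i) : LaurentSeries F)) =
      (HahnSeries.C c : LaurentSeries F) • fun i => HahnSeries.C (x i) := by
    ext1 i; simp
  -- A constant vector has a value of valuation at least `0`, so its images under `f` and `g` are
  -- power series. The constant term of `f` is the desired map: `xψ` does not contribute in degree
  -- `0`.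
  refine ⟨
    { toFun := fun z k => (f (fun i => HahnSeries.C (z i)) k).coeff 0
      map_add' := fun x y => by
        ext k
        rw [hadd, map_add]
        simp
      map_smul' := fun c x => by
        ext k
        rw [hsmul, map_smul, Pi.smul_apply, smul_eq_mul, HahnSeries.C_mul_eq_smul]
        simp }, fun z => ?_⟩
  have hz := h fun i => HahnSeries.C (z i)
  rw [laurentForm_C] at hz
  obtain ⟨h1, h2⟩ := coeff_eq_zero_of_laurentForm_coeff_eq_zero hr hr' (B := 0)
    (f := f fun i => HahnSeries.C (z i)) (g := g fun i => HahnSeries.C (z i)) (fun m hm => by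
      rw [hz]
      exact HahnSeries.coeff_single_of_ne (by omega))
  have := congrArg (fun s => HahnSeries.coeff s 0) hz
  simp only [HahnSeries.coeff_add, HahnSeries.coeff_single_mul, one_mul] at this
  rw [laurentForm_coeff_of_lt r' h2 (by norm_num), add_zero] at this
  have h3 := laurentForm_coeff_two_mul r h1
  rw [mul_zero] at h3
  rw [h3] at this
  simpa using this

end Residue

theorem doubleForm_laurentForm_anisotropic {ι : Type*} [Fintype ι] {w : ι → F}
    (hw : (QuadraticMap.weightedSumSquares F w).Anisotropic) :
    (doubleForm (laurentForm w) (HahnSeries.single (1 : ℤ) (1 : F))).Anisotropic := fun z hz => by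
  obtain ⟨h1, h2⟩ := eq_zero_of_laurentForm_add_eq_zero hw hw hz
  exact Prod.ext h1 h2

theorem anisotropic_of_laurentForm {ι : Type*} [Fintype ι] {w : ι → F}
    (hw : (laurentForm w).Anisotropic) : (QuadraticMap.weightedSumSquares F w).Anisotropic := by
  intro z hz
  have := hw (fun i => HahnSeries.C (z i)) (by rw [laurentForm_C, hz, map_zero])
  ext i
  exact HahnSeries.C_injective ((congrFun this i).trans (map_zero _).symm)

/-- A form `q ⊥ xq` contained in a multiple of a constant form forces `q = 0`. -/
theorem weightedSumSquares_eq_zero_of_double_le [Invertible (2 : F)]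
    {ι κ : Type*} [Fintype ι] [Fintype κ] {w : ι → F} {t : κ → F}
    (ht : (QuadraticMap.weightedSumSquares F t).Anisotropic) {a : LaurentSeries F} (ha : a ≠ 0)
    (h : ((ι → LaurentSeries F) × (ι → LaurentSeries F)) →ₗ[LaurentSeries F]
      (κ → LaurentSeries F))
    (hh : ∀ z, a * laurentForm t (h z) =
      doubleForm (laurentForm w) (HahnSeries.single (1 : ℤ) (1 : F)) z) (z : ι → F) :
    QuadraticMap.weightedSumSquares F w z = 0 := by
  set X : LaurentSeries F := HahnSeries.single (1 : ℤ) (1 : F) with hX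
  have hX0 : X ≠ 0 := by simp [hX]
  obtain ⟨s, b, hs, hb, hab⟩ := LaurentSeries.exists_eq_mul_self_mul ha
  -- The residue lemma is used with `φ` zero-dimensional: a constant form contained in `xψ` has only
  -- the value zero.
  have hr : (QuadraticMap.weightedSumSquares F (Empty.elim : Empty → F)).Anisotropic :=
    fun x _ => Subsingleton.elim _ _
  suffices H : ∃ g : (ι → LaurentSeries F) →ₗ[LaurentSeries F] (κ → LaurentSeries F),
      ∀ y, X * laurentForm (fun k => b * t k) (g y) = laurentForm w y by
    obtain ⟨g, hg⟩ := H
    obtain ⟨f₀, hf₀⟩ := exists_residue_linearMap hr (weightedSumSquares_const_mul_anisotropic hb ht)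
      w 0 g (fun y => by rw [← hX, hg]; simp)
    rw [← hf₀]
    simp
  rcases hab with hab | hab
  -- For `a = s²b` the copy `xq` lies in `bτ`; scaling by `x⁻¹` on vectors puts `q` inside `xbτ`.
  · refine ⟨(X⁻¹ * s) • h ∘ₗ LinearMap.inr _ _ _, fun y => ?_⟩
    have := hh (0, y)
    rw [doubleForm_apply, hab] at this
    simp only [QuadraticMap.map_zero, zero_add] at this
    rw [laurentForm_const_mul, LinearMap.smul_apply, QuadraticMap.map_smul, smul_eq_mul,
      LinearMap.comp_apply, LinearMap.inr_apply]
    apply mul_left_cancel₀ hX0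
    rw [← this]
    field_simp
  -- For `a = s²xb` the copy `q` lies in `xbτ` directly.
  · refine ⟨s • h ∘ₗ LinearMap.inl _ _ _, fun y => ?_⟩
    have := hh (y, 0)
    rw [doubleForm_apply, hab] at this
    simp only [QuadraticMap.map_zero, mul_zero, add_zero] at this
    rw [laurentForm_const_mul, LinearMap.smul_apply, QuadraticMap.map_smul, smul_eq_mul,
      LinearMap.comp_apply, LinearMap.inl_apply, ← this]
    ring

/-- If `q ⊥ xq` is contained in a multiple of `τ ⊥ xcτ`, then `q` is contained in a multiple
of `τ`. -/
theorem exists_linearMap_of_double_le [Invertible (2 : F)]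
    {ι κ : Type*} [Fintype ι] [Fintype κ] {w : ι → F} {t : κ → F}
    (ht : (QuadraticMap.weightedSumSquares F t).Anisotropic) {a : LaurentSeries F} (ha : a ≠ 0)
    {c : F} (hc : c ≠ 0)
    (h : ((ι → LaurentSeries F) × (ι → LaurentSeries F)) →ₗ[LaurentSeries F]
      ((κ → LaurentSeries F) × (κ → LaurentSeries F)))
    (hh : ∀ z, a * doubleForm (laurentForm t)
        (HahnSeries.single (1 : ℤ) (1 : F) * HahnSeries.C c) (h z) =
      doubleForm (laurentForm w) (HahnSeries.single (1 : ℤ) (1 : F)) z) :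
    ∃ b : F, b ≠ 0 ∧ ∃ f₀ : (ι → F) →ₗ[F] (κ → F), ∀ z,
      b * QuadraticMap.weightedSumSquares F t (f₀ z) = QuadraticMap.weightedSumSquares F w z := by
  set X : LaurentSeries F := HahnSeries.single (1 : ℤ) (1 : F) with hX
  obtain ⟨s, b, hs, hb, hab⟩ := LaurentSeries.exists_eq_mul_self_mul ha
  have hbc := mul_ne_zero hb hc
  have hz (z : ι → LaurentSeries F) := hh (z, 0)
  simp only [doubleForm_apply, QuadraticMap.map_zero, mul_zero, add_zero] at hz
  rcases hab with hab | hab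
  -- For `a = s²b` the ambient form is `bτ ⊥ x(bc)τ`, with first residue `bτ`.
  · obtain ⟨f₀, hf₀⟩ := exists_residue_linearMap
      (weightedSumSquares_const_mul_anisotropic hb ht)
      (weightedSumSquares_const_mul_anisotropic hbc ht) w
      (s • LinearMap.fst _ _ _ ∘ₗ h ∘ₗ LinearMap.inl _ _ _)
      (s • LinearMap.snd _ _ _ ∘ₗ h ∘ₗ LinearMap.inl _ _ _) (fun z => by
        rw [← hz, hab, laurentForm_const_mul, laurentForm_const_mul, ← hX]
        simp only [LinearMap.smul_apply, QuadraticMap.map_smul, smul_eq_mul,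
          LinearMap.comp_apply, LinearMap.inl_apply, LinearMap.fst_apply, LinearMap.snd_apply,
          map_mul]
        ring)
    exact ⟨b, hb, f₀, fun z => by rw [← hf₀, weightedSumSquares_const_mul]⟩
  -- For `a = s²xb` the summands trade places: `x²(bc)τ` becomes the constant part `(bc)τ` once `x`
  -- is absorbed into the vector.
  · obtain ⟨f₀, hf₀⟩ := exists_residue_linearMap
      (weightedSumSquares_const_mul_anisotropic hbc ht)
      (weightedSumSquares_const_mul_anisotropic hb ht) w
      ((X * s) • LinearMap.snd _ _ _ ∘ₗ h ∘ₗ LinearMap.inl _ _ _)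
      (s • LinearMap.fst _ _ _ ∘ₗ h ∘ₗ LinearMap.inl _ _ _) (fun z => by
        rw [← hz, hab, laurentForm_const_mul, laurentForm_const_mul, ← hX]
        simp only [LinearMap.smul_apply, QuadraticMap.map_smul, smul_eq_mul,
          LinearMap.comp_apply, LinearMap.inl_apply, LinearMap.fst_apply, LinearMap.snd_apply,
          map_mul]
        ring)
    exact ⟨b * c, hbc, f₀, fun z => by rw [← hf₀, weightedSumSquares_const_mul]⟩

end Laurent

/-! ### The theorem for one variable. -/

section OneVariable

variable {F : Type u} [Field F] [Invertible (2 : F)] [Invertible (2 : LaurentSeries F)]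

theorem laurentForm_congr {ι κ : Type*} [Fintype ι] [Fintype κ] {w : ι → F} {p : κ → F}
    (h : (QuadraticMap.weightedSumSquares F w).Equivalent (QuadraticMap.weightedSumSquares F p)) :
    (laurentForm w).Equivalent (laurentForm p) := by
  have h1 := baseChange_equivalent_weightedSumSquares (LaurentSeries F)
    (QuadraticMap.Equivalent.refl (QuadraticMap.weightedSumSquares F w))
  have h2 := baseChange_equivalent_weightedSumSquares (LaurentSeries F) h
  simp only [LaurentSeries.algebraMap_apply] at h1 h2
  exact h1.symm.trans h2

omit [Invertible (2 : LaurentSeries F)] [Invertible (2 : F)] in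
theorem doubleForm_laurentForm_C {ι : Type*} [Fintype ι] (w : ι → F) (a : F) :
    (laurentForm fun i : ι × Fin 2 => w i.1 * ![1, a] i.2).Equivalent
      (doubleForm (laurentForm w) (HahnSeries.C a)) :=
  (weightedSumSquares_reindex (Equiv.refl _) fun i => by
    rcases i with ⟨i, k⟩
    fin_cases k <;> simp).trans (doubleForm_weightedSumSquares _ _)

/-- A Pfister form over `F` and its extension to `F((x))` have a common diagonalization. -/
theorem exists_pfisterForm_map_C (l : List F) : ∃ (J : Type) (_ : Fintype J) (p : J → F),
    (pfisterForm l).Equivalent (QuadraticMap.weightedSumSquares F p) ∧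
    (pfisterForm (l.map (HahnSeries.C : F →+* LaurentSeries F))).Equivalent (laurentForm p) := by
  induction l with
  | nil =>
    refine ⟨Unit, inferInstance, fun _ => 1,
      pfisterForm_nil.trans sq_equivalent_weightedSumSquares, ?_⟩
    refine pfisterForm_nil.trans (sq_equivalent_weightedSumSquares.trans
      (weightedSumSquares_reindex (Equiv.refl _) fun i => by simp))
  | cons a l ih =>
    obtain ⟨J, _, p, h1, h2⟩ := ih
    refine ⟨J × Fin 2, inferInstance, fun i => p i.1 * ![1, a] i.2, ?_, ?_⟩
    · exact (pfisterForm_cons a l).trans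
        ((doubleForm_congr h1 a).trans (doubleForm_weightedSumSquares p a).symm)
    · exact (pfisterForm_cons _ _).trans
        ((doubleForm_congr h2 _).trans (doubleForm_laurentForm_C p a).symm)

/-- Over `F((x))`, every Pfister form is isometric to `τ` or `τ ⊗ ⟨1, cx⟩` with `τ` a Pfister form
over `F` and `c ∈ F`. -/
theorem exists_pfisterForm_laurent (l : List (LaurentSeries F)) (hl : ∀ a ∈ l, a ≠ 0) :
    ∃ τ : List F, (∀ a ∈ τ, a ≠ 0) ∧
      ((pfisterForm l).Equivalent (pfisterForm (τ.map (HahnSeries.C : F →+* LaurentSeries F))) ∨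
        ∃ c : F, c ≠ 0 ∧ (pfisterForm l).Equivalent (pfisterForm
          (HahnSeries.single (1 : ℤ) (1 : F) * HahnSeries.C c ::
            τ.map (HahnSeries.C : F →+* LaurentSeries F)))) := by
  induction l with
  | nil => exact ⟨[], by simp, Or.inl (QuadraticMap.Equivalent.refl _)⟩
  | cons a l ih =>
    obtain ⟨τ, hτ, ih⟩ := ih fun b hb => hl b (List.mem_cons_of_mem _ hb)
    obtain ⟨s, c, hs, hc, hac⟩ := LaurentSeries.exists_eq_mul_self_mul (hl a List.mem_cons_self)
    have hτ' (d : F) (hd : d ≠ 0) : ∀ a ∈ d :: τ, a ≠ 0 := by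
      intro a ha
      rcases List.mem_cons.mp ha with rfl | ha
      · exact hd
      · exact hτ a ha
    rcases ih with ih | ⟨d, hd, ih⟩ <;> rcases hac with rfl | rfl
    · exact ⟨c :: τ, hτ' c hc, Or.inl
        ((pfisterForm_cons_mul_sq _ hs _).trans (pfisterForm_cons_congr _ ih))⟩
    · exact ⟨τ, hτ, Or.inr ⟨c, hc,
        (pfisterForm_cons_mul_sq _ hs _).trans (pfisterForm_cons_congr _ ih)⟩⟩
    · exact ⟨c :: τ, hτ' c hc, Or.inr ⟨d, hd, (pfisterForm_cons_mul_sq _ hs _).trans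
        ((pfisterForm_cons_congr _ ih).trans (pfisterForm_swap _ _ _))⟩⟩
    -- Two slots containing `x` merge into one: `⟨1, xd⟩ ⊗ ⟨1, xc⟩ ≃ ⟨1, xd⟩ ⊗ ⟨1, x²dc⟩`, and `x²`
    -- is dropped.
    · refine ⟨(d * c) :: τ, hτ' _ (mul_ne_zero hd hc), Or.inr ⟨d, hd, ?_⟩⟩
      refine (pfisterForm_cons_mul_sq _ hs _).trans ((pfisterForm_cons_congr _ ih).trans
        ((pfisterForm_swap _ _ _).trans ((pfisterForm_cons_cons_mul ?_ _ _).trans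
          (pfisterForm_cons_congr _ ?_))))
      · exact mul_ne_zero (by simp) (by simpa using hd)
      · have : (HahnSeries.single (1 : ℤ) (1 : F) * HahnSeries.C d) *
            (HahnSeries.single (1 : ℤ) (1 : F) * HahnSeries.C c) =
            HahnSeries.single (1 : ℤ) (1 : F) * HahnSeries.single (1 : ℤ) (1 : F) *
              (HahnSeries.C (d * c) : LaurentSeries F) := by
          rw [map_mul]
          ring
        rw [this]
        exact pfisterForm_cons_mul_sq _ (by simp) _

/-- The weights of `q ⊗ ⟨1, x⟩` over `F((x))`, for `q` the diagonal form with weights `w`. -/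
noncomputable def laurentWeights {F : Type u} [Field F] {ι : Type*} (w : ι → F) :
    ι × Fin 2 → LaurentSeries F :=
  fun i => HahnSeries.C (w i.1) * ![1, HahnSeries.single (1 : ℤ) (1 : F)] i.2

omit [Invertible (2 : LaurentSeries F)] [Invertible (2 : F)] in
theorem laurentWeights_equivalent {ι : Type*} [Fintype ι] (w : ι → F) :
    (QuadraticMap.weightedSumSquares (LaurentSeries F) (laurentWeights w)).Equivalent
      (doubleForm (laurentForm w) (HahnSeries.single (1 : ℤ) (1 : F))) :=
  doubleForm_weightedSumSquares (F := LaurentSeries F) (fun i => HahnSeries.C (w i))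
    (HahnSeries.single (1 : ℤ) (1 : F))

omit [Invertible (2 : LaurentSeries F)] [Invertible (2 : F)] in
theorem laurentWeights_anisotropic {ι : Type*} [Fintype ι] {w : ι → F}
    (hw : (QuadraticMap.weightedSumSquares F w).Anisotropic) :
    (QuadraticMap.weightedSumSquares (LaurentSeries F) (laurentWeights w)).Anisotropic :=
  (laurentWeights_equivalent w).symm.anisotropic (doubleForm_laurentForm_anisotropic hw)

theorem laurentWeights_isPfister {ι : Type*} [Fintype ι] {w : ι → F}
    (hw : IsPfister (QuadraticMap.weightedSumSquares F w)) :
    IsPfister (QuadraticMap.weightedSumSquares (LaurentSeries F) (laurentWeights w)) := by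
  obtain ⟨l, hl, e⟩ := hw
  obtain ⟨J, _, p, h1, h2⟩ := exists_pfisterForm_map_C l
  refine ⟨HahnSeries.single (1 : ℤ) (1 : F) :: l.map (HahnSeries.C : F →+* LaurentSeries F), ?_, ?_⟩
  · intro a ha
    rcases List.mem_cons.mp ha with rfl | ha
    · simp
    · obtain ⟨b, hb, rfl⟩ := List.mem_map.mp ha
      simpa using hl b hb
  · exact (laurentWeights_equivalent w).trans
      ((doubleForm_congr ((laurentForm_congr (e.trans h1)).trans h2.symm) _).trans
        (pfisterForm_cons _ _).symm)

/-- Diagonalizing the complement turns the containment into an isometry of diagonal forms over `F`,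
to which `laurentForm_congr` applies. -/
theorem exists_laurentForm_linearMap {ι κ : Type*} [Fintype ι] [Fintype κ] {w : ι → F} {r : κ → F}
    {b : F} (h : IsSubform (QuadraticMap.weightedSumSquares F w)
      (b • QuadraticMap.weightedSumSquares F r)) :
    ∃ f : (ι → LaurentSeries F) →ₗ[LaurentSeries F] (κ → LaurentSeries F),
      ∀ z, HahnSeries.C b * laurentForm r (f z) = laurentForm w z := by
  obtain ⟨k, s, -, e⟩ := h
  obtain ⟨p, hp⟩ := s.equivalent_weightedSumSquares
  have hsum : ((QuadraticMap.weightedSumSquares F w).prod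
      (QuadraticMap.weightedSumSquares F p)).Equivalent
      (QuadraticMap.weightedSumSquares F (Sum.elim w p)) :=
    ⟨{ (LinearEquiv.sumArrowLequivProdArrow _ _ F F).symm with
        map_app' := fun z => by
          simp [QuadraticMap.weightedSumSquares_apply, Equiv.sumArrowEquivProdArrow,
            LinearEquiv.sumArrowLequivProdArrow] }⟩
  have hb : (QuadraticMap.weightedSumSquares F fun i => b * r i).Equivalent
      (b • QuadraticMap.weightedSumSquares F r) :=
    ⟨{ LinearEquiv.refl F (κ → F) with
        map_app' := fun z => (weightedSumSquares_const_mul b r z).symm }⟩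
  obtain ⟨E⟩ := laurentForm_congr
    (hb.trans (e.trans (((QuadraticMap.Equivalent.refl _).prod hp).trans hsum)))
  refine ⟨E.symm.toLinearEquiv.toLinearMap ∘ₗ
    (LinearEquiv.sumArrowLequivProdArrow _ _ (LaurentSeries F) (LaurentSeries F)).symm.toLinearMap ∘ₗ
      LinearMap.inl _ _ _, fun z => ?_⟩
  rw [← laurentForm_const_mul]
  refine (E.symm.map_app _).trans ?_
  simp [laurentForm_apply]

theorem laurentWeights_isNeighbour {ι κ : Type*} [Fintype ι] [Fintype κ] {w : ι → F} {r : κ → F}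
    (hw : (QuadraticMap.weightedSumSquares F w).Anisotropic)
    (hr : (QuadraticMap.weightedSumSquares F r).Anisotropic)
    (h : IsNeighbour (QuadraticMap.weightedSumSquares F w) (QuadraticMap.weightedSumSquares F r)) :
    IsNeighbour (QuadraticMap.weightedSumSquares (LaurentSeries F) (laurentWeights w))
      (QuadraticMap.weightedSumSquares (LaurentSeries F) (laurentWeights r)) := by
  obtain ⟨h1, ⟨b, hb, h2⟩, h3⟩ := h
  refine ⟨laurentWeights_isPfister h1, ⟨HahnSeries.C b, by simpa using hb, ?_⟩, ?_⟩
  · obtain ⟨f, hf⟩ := exists_laurentForm_linearMap h2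
    refine IsSubform.of_equivalent (laurentWeights_equivalent w).symm
      ((laurentWeights_equivalent r).symm.const_smul _) ?_
    refine isSubform_of_linearMap (fun z hz => ?_) (doubleForm_laurentForm_anisotropic hw)
      (f.prodMap f) fun z => ?_
    · refine doubleForm_laurentForm_anisotropic hr z ?_
      exact (mul_eq_zero.mp hz).resolve_left (by simpa using hb)
    · change HahnSeries.C b * doubleForm (laurentForm r) _ (f z.1, f z.2) = _
      simp only [doubleForm_apply, ← hf]
      ring
  · simp only [Module.finrank_fintype_fun_eq_card, Fintype.card_prod, Fintype.card_fin] at h3 ⊢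
    omega

/-- The case `c = 1` of `exists_linearMap_of_double_le`, with both dimensions halved. -/
theorem isNeighbour_of_laurentWeights_isNeighbour {ι κ : Type*} [Fintype ι] [Fintype κ]
    {w : ι → F} {r : κ → F}
    (hw : (QuadraticMap.weightedSumSquares F w).Anisotropic)
    (hr : (QuadraticMap.weightedSumSquares F r).Anisotropic)
    (hrP : IsPfister (QuadraticMap.weightedSumSquares F r))
    (h : IsNeighbour (QuadraticMap.weightedSumSquares (LaurentSeries F) (laurentWeights w))
      (QuadraticMap.weightedSumSquares (LaurentSeries F) (laurentWeights r))) :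
    IsNeighbour (QuadraticMap.weightedSumSquares F w) (QuadraticMap.weightedSumSquares F r) := by
  obtain ⟨-, ⟨a, ha, hs⟩, hd⟩ := h
  obtain ⟨f, hf⟩ := (hs.of_equivalent (laurentWeights_equivalent w)
    ((laurentWeights_equivalent r).const_smul a)).exists_linearMap
  obtain ⟨b, hb, f₀, hf₀⟩ := exists_linearMap_of_double_le hr ha (one_ne_zero (α := F)) f fun z => by
    rw [← hf, show HahnSeries.single (1 : ℤ) (1 : F) * HahnSeries.C (1 : F) =
      HahnSeries.single (1 : ℤ) (1 : F) by simp]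
    rfl
  refine ⟨hrP, ⟨b, hb, ?_⟩, ?_⟩
  · exact isSubform_of_linearMap
      (fun z hz => hr z ((mul_eq_zero.mp hz).resolve_left hb)) hw f₀ hf₀
  · simp only [Module.finrank_fintype_fun_eq_card, Fintype.card_prod, Fintype.card_fin] at hd ⊢
    omega

/-- If `q ⊗ ⟨1, x⟩` is a neighbour of a Pfister form over `F((x))`, then `q` is a neighbour of a
Pfister form over `F`. -/
theorem exists_isNeighbour_of_laurentWeights {ι : Type*} [Fintype ι] {w : ι → F}
    (hw : (QuadraticMap.weightedSumSquares F w).Anisotropic) {l : List (LaurentSeries F)}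
    (hl : ∀ a ∈ l, a ≠ 0)
    (h : IsNeighbour (QuadraticMap.weightedSumSquares (LaurentSeries F) (laurentWeights w))
      (pfisterForm l)) :
    ∃ τ : List F, (∀ a ∈ τ, a ≠ 0) ∧
      IsNeighbour (QuadraticMap.weightedSumSquares F w) (pfisterForm τ) := by
  have hani := h.anisotropic (laurentWeights_anisotropic hw)
  obtain ⟨τ, hτ, e⟩ := exists_pfisterForm_laurent l hl
  obtain ⟨J, _, t, ht, ht'⟩ := exists_pfisterForm_map_C τ
  refine ⟨τ, hτ, ?_⟩
  rcases e with e | ⟨c, hc, e⟩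
  -- A constant Pfister form would force `q = 0`, but a neighbour has positive dimension.
  · have e' := e.trans ht'
    have htani := anisotropic_of_laurentForm (e'.anisotropic hani)
    obtain ⟨-, ⟨a, ha, hs⟩, hd⟩ := h.of_equivalent (laurentWeights_equivalent w) e'
    obtain ⟨f, hf⟩ := hs.exists_linearMap
    have h0 := weightedSumSquares_eq_zero_of_double_le htani ha f hf
    have : Subsingleton (ι → F) := ⟨fun x y => (hw x (h0 x)).trans (hw y (h0 y)).symm⟩
    have hι : Module.finrank F (ι → F) = 0 := Module.finrank_zero_of_subsingleton
    simp only [Module.finrank_fintype_fun_eq_card, Module.finrank_prod] at hι hd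
    omega
  · have e' := e.trans ((pfisterForm_cons _ _).trans (doubleForm_congr ht' _))
    have htani : (QuadraticMap.weightedSumSquares F t).Anisotropic :=
      anisotropic_of_laurentForm (QuadraticMap.anisotropic_of_prod (e'.anisotropic hani)).1
    obtain ⟨-, ⟨a, ha, hs⟩, hd⟩ := h.of_equivalent (laurentWeights_equivalent w) e'
    obtain ⟨f, hf⟩ := hs.exists_linearMap
    obtain ⟨b, hb, f₀, hf₀⟩ := exists_linearMap_of_double_le htani ha hc f hf
    refine IsNeighbour.of_equivalent (QuadraticMap.Equivalent.refl _) ht.symm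
      ⟨⟨τ, hτ, ht.symm⟩, ⟨b, hb, ?_⟩, ?_⟩
    · exact isSubform_of_linearMap
        (fun z hz => htani z ((mul_eq_zero.mp hz).resolve_left hb)) hw f₀ hf₀
    · simp only [Module.finrank_fintype_fun_eq_card, Module.finrank_prod] at hd ⊢
      omega

end OneVariable

/-! ### Induction on the number of variables. -/

section Generic

theorem genericMultiple_equivalent {F : Type u} [Field F] [Invertible (2 : F)] (n : ℕ)
    {V : Type*} [AddCommGroup V] [Module F V] {q : QuadraticForm F V}
    {ι J : Type*} [Fintype ι] [Fintype J] {w : ι → F} {p : J → IterLaurent n F}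
    (hq : q.Equivalent (QuadraticMap.weightedSumSquares F w))
    (hp : (genericPfister n F).Equivalent (QuadraticMap.weightedSumSquares (IterLaurent n F) p)) :
    (genericMultiple n q).Equivalent (QuadraticMap.weightedSumSquares (IterLaurent n F)
      fun i : ι × J => IterLaurent.const n F (w i.1) * p i.2) :=
  tmul_equivalent_weightedSumSquares
    (baseChange_equivalent_weightedSumSquares (IterLaurent n F) hq) hp

/-- Along `φ : F →+* K`, with `π` the diagonal form over `K` with weights `p`: for anisotropic `q`
over `F`, `q ⊗ π` is a neighbour of `ρ ⊗ π` exactly if `q` is one of `ρ`, and if `q ⊗ π` is a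
neighbour of some Pfister form over `K`, then `q` is one of some Pfister form over `F`. -/
def ReflectsNeighbours {F : Type u} [Field F] [Invertible (2 : F)] {K : Type v} [Field K]
    (φ : F →+* K) {J : Type} [Fintype J] (p : J → K) : Prop :=
  ∀ (_ : Invertible (2 : K)) (ι : Type) [Fintype ι] (w : ι → F),
    (QuadraticMap.weightedSumSquares F w).Anisotropic →
    (∀ {κ : Type} [Fintype κ] (r : κ → F), (QuadraticMap.weightedSumSquares F r).Anisotropic →
      IsPfister (QuadraticMap.weightedSumSquares F r) →
      (IsNeighbour (QuadraticMap.weightedSumSquares K fun i : ι × J => φ (w i.1) * p i.2)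
          (QuadraticMap.weightedSumSquares K fun i : κ × J => φ (r i.1) * p i.2) ↔
        IsNeighbour (QuadraticMap.weightedSumSquares F w)
          (QuadraticMap.weightedSumSquares F r))) ∧
    ∀ (m : ℕ) (P : QuadraticForm K (Fin m → K)),
      IsNeighbour (QuadraticMap.weightedSumSquares K fun i : ι × J => φ (w i.1) * p i.2) P →
      ∃ τ : List F, (∀ a ∈ τ, a ≠ 0) ∧
        IsNeighbour (QuadraticMap.weightedSumSquares F w) (pfisterForm τ)

theorem reflectsNeighbours_id (F : Type u) [Field F] [I : Invertible (2 : F)] :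
    ReflectsNeighbours (RingHom.id F) fun _ : Unit => (1 : F) := by
  intro I' ι _ w hw
  obtain rfl := Subsingleton.elim I I'
  have e {κ : Type} [Fintype κ] (r : κ → F) : (QuadraticMap.weightedSumSquares F
      fun i : κ × Unit => RingHom.id F (r i.1) * 1).Equivalent
      (QuadraticMap.weightedSumSquares F r) :=
    weightedSumSquares_reindex (Equiv.prodPUnit κ) fun i => by simp
  refine ⟨fun r _ _ => isNeighbour_congr (e w) (e r), fun m P h => ?_⟩
  obtain ⟨τ, hτ, E⟩ := h.1
  exact ⟨τ, hτ, h.of_equivalent (e w) E⟩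

/-- Regroup `q ⊗ (⟨1, x⟩ ⊗ π)` as `(q ⊗ ⟨1, x⟩) ⊗ π`, apply the hypothesis over `F((x))`, and finish
with the one-variable results. -/
theorem ReflectsNeighbours.comp_C {F : Type u} [Field F] [Invertible (2 : F)]
    [Invertible (2 : LaurentSeries F)] {K : Type v} [Field K]
    {φ : LaurentSeries F →+* K} {J : Type} [Fintype J] {p : J → K}
    (h : ReflectsNeighbours φ p) :
    ReflectsNeighbours (φ.comp (HahnSeries.C : F →+* LaurentSeries F))
      fun i : Fin 2 × J => ![1, φ (HahnSeries.single (1 : ℤ) (1 : F))] i.1 * p i.2 := by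
  intro _ ι _ w hw
  have e {κ : Type} [Fintype κ] (r : κ → F) : (QuadraticMap.weightedSumSquares K
      fun i : κ × Fin 2 × J => φ.comp (HahnSeries.C : F →+* LaurentSeries F) (r i.1) *
        (![1, φ (HahnSeries.single (1 : ℤ) (1 : F))] i.2.1 * p i.2.2)).Equivalent
      (QuadraticMap.weightedSumSquares K fun i : (κ × Fin 2) × J =>
        φ (laurentWeights r i.1) * p i.2) :=
    weightedSumSquares_reindex (Equiv.prodAssoc κ (Fin 2) J).symm fun ⟨i, k, j⟩ => by
      simp only [Equiv.prodAssoc_symm_apply, laurentWeights, map_mul, RingHom.comp_apply, mul_assoc]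
      fin_cases k <;> simp
  obtain ⟨h1, h2⟩ := h ‹_› _ (laurentWeights w) (laurentWeights_anisotropic hw)
  constructor
  · intro κ _ r hr hrP
    rw [isNeighbour_congr (e w) (e r),
      h1 (laurentWeights r) (laurentWeights_anisotropic hr) (laurentWeights_isPfister hrP)]
    exact ⟨isNeighbour_of_laurentWeights_isNeighbour hw hr hrP,
      laurentWeights_isNeighbour hw hr⟩
  · intro m P hP
    obtain ⟨l, hl, hP'⟩ := h2 m P (hP.of_equivalent (e w) (QuadraticMap.Equivalent.refl P))
    exact exists_isNeighbour_of_laurentWeights hw hl hP'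

theorem pfisterForm_cons_equivalent_weightedSumSquares {F : Type u} [Field F] [Invertible (2 : F)]
    {J : Type*} [Fintype J] {p : J → F} (a : F) {l : List F}
    (h : (pfisterForm l).Equivalent (QuadraticMap.weightedSumSquares F p)) :
    (pfisterForm (a :: l)).Equivalent
      (QuadraticMap.weightedSumSquares F fun i : Fin 2 × J => ![1, a] i.1 * p i.2) :=
  tmul_equivalent_weightedSumSquares (QuadraticMap.Equivalent.refl (oneForm a)) h

/-- The field is quantified inside because the inductive step passes from `F` to `F((x))`.
Quantifying over the inverse of `2` avoids comparing the instances on the iterated field built from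
`F` and from `F((x))`. -/
theorem exists_genericPfister_diagonal (n : ℕ) : ∀ (F : Type u) [Field F] [Invertible (2 : F)],
    ∃ (J : Type) (_ : Fintype J) (p : J → IterLaurent n F),
      (∀ _ : Invertible (2 : IterLaurent n F), (pfisterForm (IterLaurent.vars n F)).Equivalent
        (QuadraticMap.weightedSumSquares (IterLaurent n F) p)) ∧
      ReflectsNeighbours (IterLaurent.const n F) p := by
  induction n with
  | zero =>
    intro F _ _
    exact ⟨Unit, inferInstance, fun _ => (1 : F),
      fun I => (@pfisterForm_nil F _ I).trans sq_equivalent_weightedSumSquares,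
      reflectsNeighbours_id F⟩
  | succ n ih =>
    intro F _ _
    let : Invertible (2 : LaurentSeries F) :=
      (Invertible.map (HahnSeries.C : F →+* LaurentSeries F) 2).copy 2 (map_ofNat _ _).symm
    obtain ⟨J, _, p, hp, hR⟩ := ih (LaurentSeries F)
    exact ⟨Fin 2 × J, inferInstance, fun i => ![1, IterLaurent.const n (LaurentSeries F)
        (HahnSeries.single (1 : ℤ) (1 : F))] i.1 * p i.2,
      fun I => @pfisterForm_cons_equivalent_weightedSumSquares
        (IterLaurent n (LaurentSeries F)) _ I _ _ _ _ _ (hp I),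
      hR.comp_C⟩

end Generic

theorem proposition3p4 {F : Type u} [Field F] [Invertible (2 : F)]
    {V : Type v} [AddCommGroup V] [Module F V] [FiniteDimensional F V]
    (q : QuadraticForm F V) (hq : q.Anisotropic) (n : ℕ) :
    ((∃ (m : ℕ) (P : QuadraticForm (IterLaurent n F) (Fin m → IterLaurent n F)),
        IsNeighbour (genericMultiple n q) P) ↔
      ∃ (m : ℕ) (σ : QuadraticForm F (Fin m → F)),
        IsPfister σ ∧ IsNeighbour (genericMultiple n q) (genericMultiple n σ)) ∧
    (∀ {W : Type w} [AddCommGroup W] [Module F W] [FiniteDimensional F W]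
        (ρ : QuadraticForm F W), IsPfister ρ → ρ.Anisotropic →
      (IsNeighbour (genericMultiple n q) (genericMultiple n ρ) ↔ IsNeighbour q ρ)) := by
  obtain ⟨J, _, p, hp, hR⟩ := exists_genericPfister_diagonal n F
  obtain ⟨w, hw⟩ := q.equivalent_weightedSumSquares
  have hqw := genericMultiple_equivalent n hw (hp _)
  have hwani := hw.anisotropic hq
  have main {W : Type w} [AddCommGroup W] [Module F W] [FiniteDimensional F W]
      (ρ : QuadraticForm F W) (hρ : IsPfister ρ) (hρa : ρ.Anisotropic) :
      IsNeighbour (genericMultiple n q) (genericMultiple n ρ) ↔ IsNeighbour q ρ := by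
    obtain ⟨r, hr⟩ := ρ.equivalent_weightedSumSquares
    rw [isNeighbour_congr hqw (genericMultiple_equivalent n hr (hp _)), isNeighbour_congr hw hr]
    exact (hR inferInstance _ w hwani).1 r (hr.anisotropic hρa) (hρ.of_equivalent hr.symm)
  refine ⟨⟨?_, ?_⟩, main⟩
  · rintro ⟨m, P, hP⟩
    obtain ⟨τ, hτ, hN⟩ := (hR inferInstance _ w hwani).2 m P (hP.of_equivalent hqw (QuadraticMap.Equivalent.refl P))
    obtain ⟨r, hr⟩ := (pfisterForm τ).equivalent_weightedSumSquares
    have hN' := hN.of_equivalent (QuadraticMap.Equivalent.refl _) hr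
    refine ⟨_, QuadraticMap.weightedSumSquares F r, hN'.1, ?_⟩
    rw [isNeighbour_congr hqw (genericMultiple_equivalent n (QuadraticMap.Equivalent.refl _) (hp _))]
    -- Part (ii) needs an anisotropic Pfister form; the descended one inherits this from its
    -- neighbour `q`.
    exact ((hR inferInstance _ w hwani).1 r (hN'.anisotropic hwani) hN'.1).mpr hN'
  · rintro ⟨m, σ, -, hN⟩
    obtain ⟨r, hr⟩ := σ.equivalent_weightedSumSquares
    -- Only a transport: the Pfister form must be moved to a coordinate space `Fin m → K`.
    exact ⟨_, _, hN.of_equivalent (QuadraticMap.Equivalent.refl _)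
      ((genericMultiple_equivalent n hr (hp _)).trans
        (weightedSumSquares_reindex (Fintype.equivFin _)
          (p := _ ∘ (Fintype.equivFin _).symm) fun i => by
            rw [Function.comp_apply, Equiv.symm_apply_apply]))⟩
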